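/- **Setting.** Let $W=(Y,D,X)$ have law $F_0$, with outcome $Y\in[\underline y,\bar y]$ almost surely, treatment $D\in\{0,1\}$ and covariates $X\in\mathcal X$. Let $w_i=(y_i,d_i,x_i)$, $i\ge 1$, be i.i.d. with law $F_0$. Let $\delta,\delta^*:\mathcal X\to\{0,1\}$ be (measurable) treatment rules, $\theta_{10}(x)=\mathbb 1\{\delta(x)=1,\delta^*(x)=0\}$ and $\theta_{01}(x)=\mathbb 1\{\delta(x)=0,\delta^*(x)=1\}$. A nuisance parameter is a triple of functions $\gamma=(\eta(1,\cdot),\eta(0,\cdot),p(\cdot))$ on $\mathcal X$; for a law $F$ of $(Y,D,X)$ write $\gamma(F)$ for the triple with $\eta(d,x)=E_F[Y\mid D=d,X=x]$ and $p(x)=P_F(D=1\mid X=x)$ (any versions), and $\gamma_0=\gamma(F_0)$. Put $$\underline\Delta(\gamma)(x)=(\eta(1,x)-\bar y)p(x)+(\underline y-\eta(0,x))(1-p(x)),\qquad \bar\Delta(\gamma)(x)=(\eta(1,x)-\underline y)p(x)+(\bar y-\eta(0,x))(1-p(x)).$$ The worst-case lower bound of the welfare gain is $\beta_{l,0}=E[\underline\Delta(\gamma_0)(X)\theta_{10}(X)-\bar\Delta(\gamma_0)(X)\theta_{01}(X)]$.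 For $w=(y,d,x)$ let $$m(w,\beta,\gamma)=\underline\Delta(\gamma)(x)\theta_{10}(x)-\bar\Delta(\gamma)(x)\theta_{01}(x)-\beta,$$ $$\phi_1(w,\gamma)=(\theta_{10}(x)-\theta_{01}(x))\,(\eta(1,x)+\eta(0,x)-(\underline y+\bar y))\,(d-p(x)),$$ $$\phi_2(w,\gamma)=(\theta_{10}(x)-\theta_{01}(x))\,[y-\eta(1,x)]^{d}\,[-(y-\eta(0,x))]^{1-d},$$ and $\psi(w,\beta,\gamma)=m(w,\beta,\gamma)+\phi_1(w,\gamma)+\phi_2(w,\gamma)$. Let $K>1$; for each $n$ let $\{1,\dots,n\}$ be partitioned into folds $\mathcal I_1,\dots,\mathcal I_K$, and let $\hat\gamma_k=(\hat\eta_k(1,\cdot),\hat\eta_k(0,\cdot),\hat p_k(\cdot))$ be a first-step estimate computed, in any way, from the observations not in $\mathcal I_k$. **Claim.** (1) The moment conditions $E[m(W,\beta_{l,0},\gamma_0)]=0$ and $E[\psi(W,\beta_{l,0},\gamma_0)]=0$ hold, with $m$ integrable and $\psi$ square integrable, and $\psi$ is locally robust: for every law $G$ of $(Y,D,X)$ with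 $Y$ integrable, with $F_\tau=(1-\tau)F_0+\tau G$, the expectation $E_{F_0}[\psi(W,\beta_{l,0},\gamma(F_\tau))]$ is well defined for $\tau\in[0,1]$ and has (one-sided) derivative $0$ in $\tau$ at $\tau=0$. (2) For every $n\ge 1$ and every sample, the equation $\frac1n\sum_{k=1}^K\sum_{i\in\mathcal I_k}\psi(w_i,b,\hat\gamma_k)=0$ has the unique solution $b=\hat\beta_l$, $$\begin{aligned}\hat\beta_l=\frac1n\sum_{k=1}^K\sum_{i\in\mathcal I_k}\Big[&\big((\hat\eta_k(1,x_i)-\bar y)\hat p_k(x_i)+(\underline y-\hat\eta_k(0,x_i))(1-\hat p_k(x_i))\big)\theta_{10}(x_i)\\&-\big((\hat\eta_k(1,x_i)-\underline y)\hat p_k(x_i)+(\bar y-\hat\eta_k(0,x_i))(1-\hat p_k(x_i))\big)\theta_{01}(x_i)\\&+(\theta_{10}(x_i)-\theta_{01}(x_i))(\hat\eta_k(1,x_i)+\hat\eta_k(0,x_i)-(\underline y+\bar y))(d_i-\hat p_k(x_i))\\&+(\theta_{10}(x_i)-\theta_{01}(x_i))[y_i-\hat\eta_k(1,x_i)]^{d_i}[-(y_i-\hat\eta_k(0,x_i))]^{1-d_i}\Big].\end{aligned}$$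 (3) $\sqrt n(\hat\beta_l-\beta_{l,0})\overset{d}{\longrightarrow}\mathcal N(0,\Omega_l)$ with $\Omega_l=E[\psi(W,\beta_{l,0},\gamma_0)^2]<\infty$. (4) The estimator $$\begin{aligned}\hat\Omega_l=\frac1n\sum_{k=1}^K\sum_{i\in\mathcal I_k}\Big[&\big((\hat\eta_k(1,x_i)-\bar y)\hat p_k(x_i)+(\underline y-\hat\eta_k(0,x_i))(1-\hat p_k(x_i))\big)\theta_{10}(x_i)\\&-\big((\hat\eta_k(1,x_i)-\underline y)\hat p_k(x_i)+(\bar y-\hat\eta_k(0,x_i))(1-\hat p_k(x_i))\big)\theta_{01}(x_i)-\hat\beta_l\\&+(\theta_{10}(x_i)-\theta_{01}(x_i))(\hat\eta_k(1,x_i)+\hat\eta_k(0,x_i)-(\underline y+\bar y))(d_i-\hat p_k(x_i))\\&+(\theta_{10}(x_i)-\theta_{01}(x_i))[y_i-\hat\eta_k(1,x_i)]^{d_i}[-(y_i-\hat\eta_k(0,x_i))]^{1-d_i}\Big]^2\end{aligned}$$ equals $\frac1n\sum_{k=1}^K\sum_{i\in\mathcal I_k}\psi(w_i,\hat\beta_l,\hat\gamma_k)^2$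 and is a consistent estimator of the asymptotic variance: $\hat\Omega_l\overset{p}{\longrightarrow}\Omega_l$. -/

import Mathlib

open MeasureTheory ProbabilityTheory Filter Topology

noncomputable section

namespace WelfareGain

/-- One observation `w = (y, d, x)`: outcome, binary treatment, covariates. -/
abbrev Obs (𝒳 : Type*) := ℝ × Fin 2 × 𝒳

/-- A value `γ = (η(1,·), η(0,·), p(·))` of the nuisance parameter: two conditional mean treatment
responses and a propensity score. -/
structure Nuisance (𝒳 : Type*) where
  eta1 : 𝒳 → ℝ
  eta0 : 𝒳 → ℝ
  p : 𝒳 → ℝ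

/-- `γ = γ(F)`: up to the choice of versions, `p(X) = P_F(D = 1 | X)` and
`η(D, X) = E_F[Y | D, X]`, where `(Y, D, X)` has law `F`. -/
structure IsNuisance {𝒳 : Type*} [MeasurableSpace 𝒳] (F : Measure (Obs 𝒳)) (γ : Nuisance 𝒳) :
    Prop where
  measurable_eta1 : Measurable γ.eta1
  measurable_eta0 : Measurable γ.eta0
  measurable_p : Measurable γ.p
  propensity :
    F[fun w : Obs 𝒳 => if w.2.1 = 1 then (1 : ℝ) else 0 |
        MeasurableSpace.comap (fun w : Obs 𝒳 => w.2.2) inferInstance]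
      =ᵐ[F] fun w => γ.p w.2.2
  response :
    F[fun w : Obs 𝒳 => w.1 | MeasurableSpace.comap (fun w : Obs 𝒳 => w.2) inferInstance]
      =ᵐ[F] fun w => if w.2.1 = 1 then γ.eta1 w.2.2 else γ.eta0 w.2.2

/-- `θ₁₀(x) = 1{δ(x) = 1, δ*(x) = 0}`. -/
def theta10 {𝒳 : Type*} (δ δs : 𝒳 → Fin 2) (x : 𝒳) : ℝ :=
  if δ x = 1 ∧ δs x = 0 then 1 else 0

/-- `θ₀₁(x) = 1{δ(x) = 0, δ*(x) = 1}`. -/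
def theta01 {𝒳 : Type*} (δ δs : 𝒳 → Fin 2) (x : 𝒳) : ℝ :=
  if δ x = 0 ∧ δs x = 1 then 1 else 0

/-- Worst-case lower bound on the conditional average treatment effect at `x`. -/
def cateLower {𝒳 : Type*} (ylo yhi : ℝ) (γ : Nuisance 𝒳) (x : 𝒳) : ℝ :=
  (γ.eta1 x - yhi) * γ.p x + (ylo - γ.eta0 x) * (1 - γ.p x)

/-- Worst-case upper bound on the conditional average treatment effect at `x`. -/
def cateUpper {𝒳 : Type*} (ylo yhi : ℝ) (γ : Nuisance 𝒳) (x : 𝒳) : ℝ :=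
  (γ.eta1 x - ylo) * γ.p x + (yhi - γ.eta0 x) * (1 - γ.p x)

/-- The worst-case lower bound `β_l` of the welfare gain of `δ` over `δ*`. -/
def betaLower {𝒳 : Type*} [MeasurableSpace 𝒳] (ylo yhi : ℝ) (δ δs : 𝒳 → Fin 2)
    (F : Measure (Obs 𝒳)) (γ : Nuisance 𝒳) : ℝ :=
  ∫ w, (cateLower ylo yhi γ w.2.2 * theta10 δ δs w.2.2
    - cateUpper ylo yhi γ w.2.2 * theta01 δ δs w.2.2) ∂F

/-- The original (plug-in) moment function `m(w, β, γ)`. -/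
def plugMoment {𝒳 : Type*} (ylo yhi : ℝ) (δ δs : 𝒳 → Fin 2) (w : Obs 𝒳) (β : ℝ) (γ : Nuisance 𝒳) :
    ℝ :=
  cateLower ylo yhi γ w.2.2 * theta10 δ δs w.2.2
    - cateUpper ylo yhi γ w.2.2 * theta01 δ δs w.2.2 - β

/-- The adjustment term `φ₁` for the first-step estimation of the propensity score. -/
def phi1 {𝒳 : Type*} (ylo yhi : ℝ) (δ δs : 𝒳 → Fin 2) (w : Obs 𝒳) (γ : Nuisance 𝒳) : ℝ :=
  (theta10 δ δs w.2.2 - theta01 δ δs w.2.2) * (γ.eta1 w.2.2 + γ.eta0 w.2.2 - (ylo + yhi))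
    * (((w.2.1 : ℕ) : ℝ) - γ.p w.2.2)

/-- The adjustment term `φ₂` for the first-step estimation of the mean responses. -/
def phi2 {𝒳 : Type*} (δ δs : 𝒳 → Fin 2) (w : Obs 𝒳) (γ : Nuisance 𝒳) : ℝ :=
  (theta10 δ δs w.2.2 - theta01 δ δs w.2.2) * (w.1 - γ.eta1 w.2.2) ^ (w.2.1 : ℕ)
    * (-(w.1 - γ.eta0 w.2.2)) ^ (1 - (w.2.1 : ℕ))

/-- The orthogonalized moment function `ψ = m + φ`, `φ = φ₁ + φ₂`. -/
def psi {𝒳 : Type*} (ylo yhi : ℝ) (δ δs : 𝒳 → Fin 2) (w : Obs 𝒳) (β : ℝ) (γ : Nuisance 𝒳) : ℝ :=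
  plugMoment ylo yhi δ δs w β γ + (phi1 ylo yhi δ δs w γ + phi2 δ δs w γ)

/-- `F_τ = (1 - τ) F₀ + τ G`. -/
def mixture {𝒳 : Type*} [MeasurableSpace 𝒳] (F₀ G : Measure (Obs 𝒳)) (τ : ℝ) : Measure (Obs 𝒳) :=
  ENNReal.ofReal (1 - τ) • F₀ + ENNReal.ofReal τ • G

/-- Local robustness (Neyman orthogonality) under `F₀` of a moment function `g` that depends on
the nuisance parameter: for every alternative law `G` with integrable outcome and every choice
`γ_τ` of versions of `γ(F_τ)`, the map `τ ↦ E_{F₀}[g(w, γ(F_τ))]` on `[0, 1]` is well defined and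
has derivative zero at `τ = 0`. -/
def IsLocallyRobust {𝒳 : Type*} [MeasurableSpace 𝒳] (F₀ : Measure (Obs 𝒳))
    (g : Obs 𝒳 → Nuisance 𝒳 → ℝ) : Prop :=
  ∀ G : Measure (Obs 𝒳), IsProbabilityMeasure G → Integrable (fun w : Obs 𝒳 => w.1) G →
    ∀ γ : ℝ → Nuisance 𝒳, (∀ τ ∈ Set.Icc (0 : ℝ) 1, IsNuisance (mixture F₀ G τ) (γ τ)) →
      (∀ τ ∈ Set.Icc (0 : ℝ) 1, Integrable (fun w => g w (γ τ)) F₀) ∧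
      HasDerivWithinAt (fun τ => ∫ w, g w (γ τ) ∂F₀) 0 (Set.Icc 0 1) 0

/-- A first-step estimation procedure for a given sample size `n` and a given assignment
`fold : Fin n → Fin K` of the observations to `K` folds: for each `k` it computes an estimate of
the nuisance parameter from the observations that are not in fold `k`. -/
abbrev FirstStep (𝒳 : Type*) {n K : ℕ} (fold : Fin n → Fin K) :=
  (k : Fin K) → ({i : Fin n // fold i ≠ k} → Obs 𝒳) → Nuisance 𝒳

/-- The fold-specific estimate `γ̂_k`, computed from the sample `w₁, …, w_n` without fold `k`. -/
def gammaHat {𝒳 : Type*} {n K : ℕ} {fold : Fin n → Fin K} (est : FirstStep 𝒳 fold)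
    (w : Fin n → Obs 𝒳) (k : Fin K) : Nuisance 𝒳 :=
  est k (fun i => w i.1)

/-- The cross-fitted average `(1/n) ∑_k ∑_{i ∈ I_k} f(w_i, γ̂_k)`. -/
def crossFit {𝒳 : Type*} {n K : ℕ} {fold : Fin n → Fin K} (est : FirstStep 𝒳 fold)
    (w : Fin n → Obs 𝒳) (f : Obs 𝒳 → Nuisance 𝒳 → ℝ) : ℝ :=
  (1 / (n : ℝ)) * ∑ k : Fin K, ∑ i ∈ Finset.univ.filter (fun i => fold i = k),
    f (w i) (gammaHat est w k)

/-- The explicit estimator `β̂_l` of the worst-case lower bound. -/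
def betaHat {𝒳 : Type*} (ylo yhi : ℝ) (δ δs : 𝒳 → Fin 2) {n K : ℕ} {fold : Fin n → Fin K}
    (est : FirstStep 𝒳 fold) (w : Fin n → Obs 𝒳) : ℝ :=
  crossFit est w fun (y, d, x) γ =>
    ((γ.eta1 x - yhi) * γ.p x + (ylo - γ.eta0 x) * (1 - γ.p x)) * theta10 δ δs x
      - ((γ.eta1 x - ylo) * γ.p x + (yhi - γ.eta0 x) * (1 - γ.p x)) * theta01 δ δs x
      + (theta10 δ δs x - theta01 δ δs x) * (γ.eta1 x + γ.eta0 x - (ylo + yhi))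
          * (((d : ℕ) : ℝ) - γ.p x)
      + (theta10 δ δs x - theta01 δ δs x) * (y - γ.eta1 x) ^ (d : ℕ)
          * (-(y - γ.eta0 x)) ^ (1 - (d : ℕ))

/-- The explicit estimator `Ω̂_l` of the asymptotic variance of `β̂_l`. -/
def omegaHat {𝒳 : Type*} (ylo yhi : ℝ) (δ δs : 𝒳 → Fin 2) {n K : ℕ} {fold : Fin n → Fin K}
    (est : FirstStep 𝒳 fold) (w : Fin n → Obs 𝒳) : ℝ :=
  crossFit est w fun (y, d, x) γ =>
    (((γ.eta1 x - yhi) * γ.p x + (ylo - γ.eta0 x) * (1 - γ.p x)) * theta10 δ δs x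
      - ((γ.eta1 x - ylo) * γ.p x + (yhi - γ.eta0 x) * (1 - γ.p x)) * theta01 δ δs x
      - betaHat ylo yhi δ δs est w
      + (theta10 δ δs x - theta01 δ δs x) * (γ.eta1 x + γ.eta0 x - (ylo + yhi))
          * (((d : ℕ) : ℝ) - γ.p x)
      + (theta10 δ δs x - theta01 δ δs x) * (y - γ.eta1 x) ^ (d : ℕ)
          * (-(y - γ.eta0 x)) ^ (1 - (d : ℕ))) ^ 2

/-- The asymptotic variance `Ω_l = E_F[ψ(w, β_l, γ)²]`. -/
def asymVar {𝒳 : Type*} [MeasurableSpace 𝒳] (ylo yhi : ℝ) (δ δs : 𝒳 → Fin 2)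
    (F : Measure (Obs 𝒳)) (γ : Nuisance 𝒳) : ℝ :=
  ∫ w, psi ylo yhi δ δs w (betaLower ylo yhi δ δs F γ) γ ^ 2 ∂F

end WelfareGain

end

namespace WelfareGain

/-! The nuisance parameter cancels from `psi` exactly, not just to first order. Where θ₁₀ = 1 and
θ₀₁ = 0, `psi` + β equals y − yhi if d = 1 and ylo − y if d = 0, for every γ: the unobserved
potential outcome is replaced by its worst-case bound. Hence `psi` = `score` − β
(`psi_eq_score_sub`), where `score` is bounded and depends on the data alone. Local robustness is
then the derivative of a constant, and whatever the first step does, `betaHat` and `omegaHat` are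
the sample mean and sample variance of i.i.d. scores. The central limit theorem and the strong law
finish the proof.

The probabilistic content is that `score` has mean `betaLower`
(`integrable_plugIn_and_integral_eq`): condition on (D, X) to turn Y into η, then on X to turn D
into p. The versions η and p need not be bounded, so each integrability claim is carried through the
conditioning. -/

/-- Integrability and integral of a product are unchanged when the second factor is replaced by
its conditional expectation and the first factor is measurable for the conditioning σ-algebra. -/
theorem integrable_mul_condExp_and_integral_eq {α : Type*} {m m₀ : MeasurableSpace α}
    {μ : Measure α} [IsFiniteMeasure μ] (hm : m ≤ m₀) {f g q : α → ℝ}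
    (hf : StronglyMeasurable[m] f) (hg : Integrable g μ) (hfg : Integrable (fun a => f a * g a) μ)
    (hq : μ[g | m] =ᵐ[μ] q) :
    Integrable (fun a => f a * q a) μ ∧ ∫ a, f a * q a ∂μ = ∫ a, f a * g a ∂μ := by
  -- Once `f * q` is a version of a conditional expectation, its integrability is automatic; no
  -- bound on `f` or `q` is needed.
  have h : μ[f * g | m] =ᵐ[μ] fun a => f a * q a := by
    filter_upwards [condExp_mul_of_stronglyMeasurable_left hf hfg hg, hq] with a h1 h2
    rw [h1, Pi.mul_apply, h2]
  refine ⟨integrable_condExp.congr h, ?_⟩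
  rw [← integral_congr_ae h, integral_condExp hm]
  rfl

/-! ### Cancellation of the nuisance parameter and finite-sample algebra -/

variable {𝒳 : Type*}

/-- The part of the orthogonalized moment function that does not involve the parameter `β`. The
nuisance parameter cancels from it. -/
def score (ylo yhi : ℝ) (δ δs : 𝒳 → Fin 2) (w : Obs 𝒳) : ℝ :=
  theta10 δ δs w.2.2 * (ylo - (ylo + yhi) * ((w.2.1 : ℕ) : ℝ) + (2 * ((w.2.1 : ℕ) : ℝ) - 1) * w.1)
    - theta01 δ δs w.2.2
      * (yhi - (ylo + yhi) * ((w.2.1 : ℕ) : ℝ) + (2 * ((w.2.1 : ℕ) : ℝ) - 1) * w.1)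

theorem psi_eq_score_sub (ylo yhi : ℝ) (δ δs : 𝒳 → Fin 2) (w : Obs 𝒳) (β : ℝ) (γ : Nuisance 𝒳) :
    psi ylo yhi δ δs w β γ = score ylo yhi δ δs w - β := by
  obtain ⟨y, d, x⟩ := w
  fin_cases d <;>
    simp [psi, plugMoment, phi1, phi2, score, cateLower, cateUpper] <;> ring

/-- Each of the θ₁₀ and θ₀₁ terms is at most yhi − ylo in absolute value; the factor 2 avoids using
that they never occur together. -/
theorem abs_score_le {ylo yhi : ℝ} (δ δs : 𝒳 → Fin 2) {w : Obs 𝒳}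
    (hw : w.1 ∈ Set.Icc ylo yhi) : |score ylo yhi δ δs w| ≤ 2 * (yhi - ylo) := by
  obtain ⟨y, d, x⟩ := w
  obtain ⟨h1, h2⟩ := hw
  simp only at h1 h2
  rw [abs_le]
  fin_cases d <;> simp only [score, theta10, theta01] <;> split_ifs <;> norm_num <;>
    first | linarith | (constructor <;> linarith)

theorem crossFit_eq_sum {n K : ℕ} {fold : Fin n → Fin K} (est : FirstStep 𝒳 fold)
    (w : Fin n → Obs 𝒳) (f : Obs 𝒳 → Nuisance 𝒳 → ℝ) (g : Obs 𝒳 → ℝ) (h : ∀ v γ, f v γ = g v) :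
    crossFit est w f = (1 / (n : ℝ)) * ∑ i, g (w i) := by
  simp only [crossFit, h]
  rw [Finset.sum_fiberwise]

theorem crossFit_psi_eq (ylo yhi : ℝ) (δ δs : 𝒳 → Fin 2) {n K : ℕ} {fold : Fin n → Fin K}
    (est : FirstStep 𝒳 fold) (w : Fin n → Obs 𝒳) (b : ℝ) :
    crossFit est w (fun v γ => psi ylo yhi δ δs v b γ)
      = (1 / (n : ℝ)) * ∑ i, (score ylo yhi δ δs (w i) - b) :=
  crossFit_eq_sum est w _ (fun v => score ylo yhi δ δs v - b)
    fun v γ => psi_eq_score_sub ylo yhi δ δs v b γ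

theorem betaHat_eq_mean_score (ylo yhi : ℝ) (δ δs : 𝒳 → Fin 2) {n K : ℕ} {fold : Fin n → Fin K}
    (est : FirstStep 𝒳 fold) (w : Fin n → Obs 𝒳) :
    betaHat ylo yhi δ δs est w = (1 / (n : ℝ)) * ∑ i, score ylo yhi δ δs (w i) := by
  refine crossFit_eq_sum est w _ _ fun v γ => ?_
  -- The summand of `betaHat` is `psi` at β = 0, up to regrouping.
  have h := psi_eq_score_sub ylo yhi δ δs v 0 γ
  rw [sub_zero] at h
  rw [← h]
  simp only [psi, plugMoment, phi1, phi2, cateLower, cateUpper]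
  ring

theorem omegaHat_eq_crossFit_psi_sq (ylo yhi : ℝ) (δ δs : 𝒳 → Fin 2) {n K : ℕ}
    {fold : Fin n → Fin K} (est : FirstStep 𝒳 fold) (w : Fin n → Obs 𝒳) :
    omegaHat ylo yhi δ δs est w
      = crossFit est w (fun v γ => psi ylo yhi δ δs v (betaHat ylo yhi δ δs est w) γ ^ 2) := by
  unfold omegaHat
  congr 1
  funext v γ
  simp only [psi, plugMoment, phi1, phi2, cateLower, cateUpper]
  ring

theorem omegaHat_eq_mean_sq_sub (ylo yhi : ℝ) (δ δs : 𝒳 → Fin 2) {n K : ℕ}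
    {fold : Fin n → Fin K} (est : FirstStep 𝒳 fold) (w : Fin n → Obs 𝒳) :
    omegaHat ylo yhi δ δs est w
      = (1 / (n : ℝ)) * ∑ i, score ylo yhi δ δs (w i) ^ 2
        - ((1 / (n : ℝ)) * ∑ i, score ylo yhi δ δs (w i)) ^ 2 := by
  rw [omegaHat_eq_crossFit_psi_sq, crossFit_eq_sum est w _
    (fun v => (score ylo yhi δ δs v - betaHat ylo yhi δ δs est w) ^ 2)
    fun v γ => by rw [psi_eq_score_sub], betaHat_eq_mean_score]
  rcases Nat.eq_zero_or_pos n with rfl | hn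
  · simp
  have hn' : (n : ℝ) ≠ 0 := by positivity
  simp only [sub_sq, Finset.sum_add_distrib, Finset.sum_sub_distrib, Finset.sum_const,
    Finset.card_univ, Fintype.card_fin, nsmul_eq_mul, ← Finset.sum_mul, ← Finset.mul_sum]
  field_simp
  ring

/-! ### Moments of the score -/

variable [MeasurableSpace 𝒳]

theorem measurable_theta10 {δ δs : 𝒳 → Fin 2} (hδ : Measurable δ) (hδs : Measurable δs) :
    Measurable (theta10 δ δs) :=
  Measurable.ite ((measurableSet_eq_fun hδ measurable_const).inter
    (measurableSet_eq_fun hδs measurable_const)) measurable_const measurable_const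

theorem measurable_theta01 {δ δs : 𝒳 → Fin 2} (hδ : Measurable δ) (hδs : Measurable δs) :
    Measurable (theta01 δ δs) :=
  Measurable.ite ((measurableSet_eq_fun hδ measurable_const).inter
    (measurableSet_eq_fun hδs measurable_const)) measurable_const measurable_const

theorem measurable_treatment_cast : Measurable fun d : Fin 2 => ((d : ℕ) : ℝ) :=
  measurable_of_finite _

theorem measurable_score (ylo yhi : ℝ) {δ δs : 𝒳 → Fin 2} (hδ : Measurable δ)
    (hδs : Measurable δs) : Measurable (score ylo yhi δ δs) := by
  have h1 : Measurable fun w : Obs 𝒳 => theta10 δ δs w.2.2 :=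
    (measurable_theta10 hδ hδs).comp (by fun_prop)
  have h2 : Measurable fun w : Obs 𝒳 => theta01 δ δs w.2.2 :=
    (measurable_theta01 hδ hδs).comp (by fun_prop)
  have h3 : Measurable fun w : Obs 𝒳 => ((w.2.1 : ℕ) : ℝ) :=
    measurable_treatment_cast.comp (by fun_prop)
  unfold score
  fun_prop

theorem memLp_score {ylo yhi : ℝ} {δ δs : 𝒳 → Fin 2} (hδ : Measurable δ) (hδs : Measurable δs)
    {F : Measure (Obs 𝒳)} [IsProbabilityMeasure F] (hY : ∀ᵐ w ∂F, w.1 ∈ Set.Icc ylo yhi)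
    (p : ENNReal) : MemLp (score ylo yhi δ δs) p F :=
  MemLp.of_bound (measurable_score ylo yhi hδ hδs).aestronglyMeasurable (2 * (yhi - ylo))
    (hY.mono fun _ hw => abs_score_le δ δs hw)

/-- The plug-in integrand is integrable and has the same mean as the score. -/
theorem integrable_plugIn_and_integral_eq {ylo yhi : ℝ} {δ δs : 𝒳 → Fin 2} (hδ : Measurable δ)
    (hδs : Measurable δs) {F : Measure (Obs 𝒳)} [IsProbabilityMeasure F]
    (hY : ∀ᵐ w ∂F, w.1 ∈ Set.Icc ylo yhi) {γ : Nuisance 𝒳} (hγ : IsNuisance F γ) :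
    Integrable (fun w => cateLower ylo yhi γ w.2.2 * theta10 δ δs w.2.2
        - cateUpper ylo yhi γ w.2.2 * theta01 δ δs w.2.2) F ∧
      ∫ w, (cateLower ylo yhi γ w.2.2 * theta10 δ δs w.2.2
        - cateUpper ylo yhi γ w.2.2 * theta01 δ δs w.2.2) ∂F = ∫ w, score ylo yhi δ δs w ∂F := by
  have mt10 := measurable_theta10 hδ hδs
  have mt01 := measurable_theta01 hδ hδs
  have me1 := hγ.measurable_eta1
  have me0 := hγ.measurable_eta0
  have mp := hγ.measurable_p
  have mX : Measurable fun w : Obs 𝒳 => w.2.2 := by fun_prop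
  have mDX : Measurable fun w : Obs 𝒳 => w.2 := by fun_prop
  -- The score is affine in Y: u(D, X) Y + v(D, X). After Y becomes η(D, X), it reads a(X) D + b(X)
  -- (1 − D), which is affine in D.
  let u : Fin 2 × 𝒳 → ℝ := fun z =>
    (2 * ((z.1 : ℕ) : ℝ) - 1) * (theta10 δ δs z.2 - theta01 δ δs z.2)
  let v : Fin 2 × 𝒳 → ℝ := fun z => theta10 δ δs z.2 * (ylo - (ylo + yhi) * ((z.1 : ℕ) : ℝ))
    - theta01 δ δs z.2 * (yhi - (ylo + yhi) * ((z.1 : ℕ) : ℝ))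
  let η : Fin 2 × 𝒳 → ℝ := fun z => if z.1 = 1 then γ.eta1 z.2 else γ.eta0 z.2
  let a : 𝒳 → ℝ := fun x =>
    (γ.eta1 x - yhi) * theta10 δ δs x - (γ.eta1 x - ylo) * theta01 δ δs x
  let b : 𝒳 → ℝ := fun x =>
    (ylo - γ.eta0 x) * theta10 δ δs x - (yhi - γ.eta0 x) * theta01 δ δs x
  have mc : Measurable fun z : Fin 2 × 𝒳 => ((z.1 : ℕ) : ℝ) :=
    measurable_treatment_cast.comp measurable_fst
  have m1 : Measurable fun z : Fin 2 × 𝒳 => theta10 δ δs z.2 := mt10.comp measurable_snd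
  have m2 : Measurable fun z : Fin 2 × 𝒳 => theta01 δ δs z.2 := mt01.comp measurable_snd
  have mu : Measurable u := by fun_prop
  have mv : Measurable v := by fun_prop
  have ma : Measurable a := by fun_prop
  have mb : Measurable b := by fun_prop
  have hθ : ∀ x, |theta10 δ δs x| ≤ 1 ∧ |theta01 δ δs x| ≤ 1 := fun x => by
    constructor
    · unfold theta10; split_ifs <;> simp
    · unfold theta01; split_ifs <;> simp
  have hYint : Integrable (fun w : Obs 𝒳 => w.1) F := by
    refine Integrable.of_bound (by fun_prop) (max |ylo| |yhi|) (hY.mono fun w hw => ?_)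
    exact abs_le_max_abs_abs hw.1 hw.2
  have hubound : ∀ z, ‖u z‖ ≤ 2 := by
    rintro ⟨d, x⟩
    obtain ⟨h1, h2⟩ := hθ x
    rw [abs_le] at h1 h2
    rw [Real.norm_eq_abs, abs_le]
    fin_cases d <;> simp only [u] <;> norm_num <;> constructor <;> linarith
  have huY : Integrable (fun w : Obs 𝒳 => u w.2 * w.1) F :=
    hYint.bdd_mul (c := 2) (mu.comp mDX).aestronglyMeasurable (ae_of_all _ fun w => hubound _)
  have hsc : ∀ w : Obs 𝒳, score ylo yhi δ δs w = u w.2 * w.1 + v w.2 := fun w => by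
    simp only [score, u, v]; ring
  have hv : Integrable (fun w : Obs 𝒳 => v w.2) F := by
    refine (((memLp_score hδ hδs hY 1).integrable le_rfl).sub huY).congr (ae_of_all _ fun w => ?_)
    simp only [Pi.sub_apply, hsc]; ring
  obtain ⟨huη, huη'⟩ := integrable_mul_condExp_and_integral_eq (f := fun w : Obs 𝒳 => u w.2)
    mDX.comap_le (mu.comp (comap_measurable _)).stronglyMeasurable hYint huY hγ.response
  have hr : ∀ w : Obs 𝒳, u w.2 * η w.2 + v w.2
      = a w.2.2 * (if w.2.1 = 1 then 1 else 0) + b w.2.2 * (1 - if w.2.1 = 1 then 1 else 0) := by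
    rintro ⟨y, d, x⟩
    fin_cases d <;> simp [u, v, η, a, b] <;> ring
  have hrint : Integrable (fun w : Obs 𝒳 => u w.2 * η w.2 + v w.2) F := huη.add hv
  have mD : Measurable fun w : Obs 𝒳 => if w.2.1 = 1 then (1 : ℝ) else 0 :=
    Measurable.ite (measurableSet_eq_fun (by fun_prop) measurable_const)
      measurable_const measurable_const
  have hDint : Integrable (fun w : Obs 𝒳 => if w.2.1 = 1 then (1 : ℝ) else 0) F :=
    Integrable.of_bound mD.aestronglyMeasurable 1
      (ae_of_all _ fun w => by split_ifs <;> simp)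
  -- `a` and `b` may be non-integrable on their own. Multiplying the integrable a D + b (1 − D) by
  -- the indicator D isolates a D, and subtraction then gives b (1 − D).
  have haD : Integrable (fun w : Obs 𝒳 => a w.2.2 * (if w.2.1 = 1 then 1 else 0)) F := by
    refine (hrint.bdd_mul (c := 1) mD.aestronglyMeasurable
      (ae_of_all _ fun w => by split_ifs <;> simp)).congr (ae_of_all _ fun w => ?_)
    simp only [hr]
    split_ifs <;> simp
  have hbD : Integrable (fun w : Obs 𝒳 => b w.2.2 * (1 - if w.2.1 = 1 then 1 else 0)) F := by
    refine (hrint.sub haD).congr (ae_of_all _ fun w => ?_)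
    simp only [Pi.sub_apply, hr]; ring
  obtain ⟨hap, hap'⟩ := integrable_mul_condExp_and_integral_eq (f := fun w : Obs 𝒳 => a w.2.2)
    mX.comap_le (ma.comp (comap_measurable _)).stronglyMeasurable hDint haD hγ.propensity
  have hprop0 : F[fun w : Obs 𝒳 => 1 - (if w.2.1 = 1 then (1 : ℝ) else 0) |
      MeasurableSpace.comap (fun w : Obs 𝒳 => w.2.2) inferInstance]
        =ᵐ[F] fun w => 1 - γ.p w.2.2 := by
    have h := condExp_sub (μ := F) (integrable_const (1 : ℝ)) hDint
      (MeasurableSpace.comap (fun w : Obs 𝒳 => w.2.2) inferInstance)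
    filter_upwards [h, hγ.propensity] with w h1 h2
    refine h1.trans ?_
    rw [Pi.sub_apply, h2, condExp_const mX.comap_le]
  obtain ⟨hbp, hbp'⟩ := integrable_mul_condExp_and_integral_eq (f := fun w : Obs 𝒳 => b w.2.2)
    mX.comap_le (mb.comp (comap_measurable _)).stronglyMeasurable
    ((integrable_const (1 : ℝ)).sub hDint) hbD hprop0
  have hB : (fun w : Obs 𝒳 => cateLower ylo yhi γ w.2.2 * theta10 δ δs w.2.2
        - cateUpper ylo yhi γ w.2.2 * theta01 δ δs w.2.2)
      = fun w => a w.2.2 * γ.p w.2.2 + b w.2.2 * (1 - γ.p w.2.2) := by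
    funext w
    simp only [cateLower, cateUpper, a, b]; ring
  rw [hB]
  refine ⟨hap.add hbp, ?_⟩
  rw [integral_add hap hbp, hap', hbp']
  calc _ = ∫ w : Obs 𝒳, (u w.2 * η w.2 + v w.2) ∂F := by
        simp only [hr]
        exact (integral_add haD hbD).symm
    _ = (∫ w : Obs 𝒳, u w.2 * w.1 ∂F) + ∫ w : Obs 𝒳, v w.2 ∂F := by
        rw [← huη']
        exact integral_add huη hv
    _ = _ := by
        rw [← integral_add huY hv]
        simp only [hsc]

theorem integral_score_eq_betaLower {ylo yhi : ℝ} {δ δs : 𝒳 → Fin 2} (hδ : Measurable δ)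
    (hδs : Measurable δs) {F : Measure (Obs 𝒳)} [IsProbabilityMeasure F]
    (hY : ∀ᵐ w ∂F, w.1 ∈ Set.Icc ylo yhi) {γ : Nuisance 𝒳} (hγ : IsNuisance F γ) :
    ∫ w, score ylo yhi δ δs w ∂F = betaLower ylo yhi δ δs F γ :=
  (integrable_plugIn_and_integral_eq hδ hδs hY hγ).2.symm

theorem asymVar_eq_variance_score {ylo yhi : ℝ} {δ δs : 𝒳 → Fin 2} (hδ : Measurable δ)
    (hδs : Measurable δs) {F : Measure (Obs 𝒳)} [IsProbabilityMeasure F]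
    (hY : ∀ᵐ w ∂F, w.1 ∈ Set.Icc ylo yhi) {γ : Nuisance 𝒳} (hγ : IsNuisance F γ) :
    asymVar ylo yhi δ δs F γ = Var[score ylo yhi δ δs; F] := by
  rw [variance_eq_integral (measurable_score ylo yhi hδ hδs).aemeasurable,
    integral_score_eq_betaLower hδ hδs hY hγ]
  simp only [asymVar, psi_eq_score_sub]

end WelfareGain

/-! ### Limit theorems for the i.i.d. scores -/

open WelfareGain in
theorem corollary7
    {𝒳 : Type*} [MeasurableSpace 𝒳]
    {Ω : Type*} [MeasurableSpace Ω] (P : Measure Ω) [IsProbabilityMeasure P]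
    (F₀ : Measure (WelfareGain.Obs 𝒳)) [IsProbabilityMeasure F₀]
    (ylo yhi : ℝ) (hY : ∀ᵐ w ∂F₀, w.1 ∈ Set.Icc ylo yhi)
    (δ δs : 𝒳 → Fin 2) (hδ : Measurable δ) (hδs : Measurable δs)
    (γ₀ : WelfareGain.Nuisance 𝒳) (hγ₀ : WelfareGain.IsNuisance F₀ γ₀)
    (w : ℕ → Ω → WelfareGain.Obs 𝒳) (hw : ∀ i, Measurable (w i))
    (hlaw : ∀ i, P.map (w i) = F₀) (hindep : iIndepFun w P)
    (K : ℕ) (hK : 1 < K) (fold : (n : ℕ) → Fin n → Fin K)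
    (est : (n : ℕ) → WelfareGain.FirstStep 𝒳 (fold n)) :
    -- the plug-in and the orthogonalized moment conditions hold at the true values
    (Integrable (fun v => WelfareGain.plugMoment ylo yhi δ δs v
          (WelfareGain.betaLower ylo yhi δ δs F₀ γ₀) γ₀) F₀ ∧
      ∫ v, WelfareGain.plugMoment ylo yhi δ δs v
          (WelfareGain.betaLower ylo yhi δ δs F₀ γ₀) γ₀ ∂F₀ = 0) ∧
    (MemLp (fun v => WelfareGain.psi ylo yhi δ δs v
          (WelfareGain.betaLower ylo yhi δ δs F₀ γ₀) γ₀) 2 F₀ ∧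
      ∫ v, WelfareGain.psi ylo yhi δ δs v
          (WelfareGain.betaLower ylo yhi δ δs F₀ γ₀) γ₀ ∂F₀ = 0) ∧
    -- the orthogonalized moment condition is locally robust
    WelfareGain.IsLocallyRobust F₀ (fun v γ => WelfareGain.psi ylo yhi δ δs v
        (WelfareGain.betaLower ylo yhi δ δs F₀ γ₀) γ) ∧
    -- the cross-fitted orthogonalized moment equation has the explicit unique solution
    (∀ n : ℕ, 0 < n → ∀ ω : Ω, ∀ b : ℝ,
      WelfareGain.crossFit (est n) (fun i : Fin n => w i ω)
          (fun v γ => WelfareGain.psi ylo yhi δ δs v b γ) = 0 ↔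
        b = WelfareGain.betaHat ylo yhi δ δs (est n) (fun i : Fin n => w i ω)) ∧
    -- its asymptotic variance is `Ω_l`
    TendstoInDistribution
      (fun (n : ℕ) (ω : Ω) => Real.sqrt n *
        (WelfareGain.betaHat ylo yhi δ δs (est n) (fun i : Fin n => w i ω)
          - WelfareGain.betaLower ylo yhi δ δs F₀ γ₀))
      atTop (id : ℝ → ℝ) (fun _ => P)
      (gaussianReal 0 (WelfareGain.asymVar ylo yhi δ δs F₀ γ₀).toNNReal) ∧
    -- the explicit variance estimator is the cross-fitted average of `ψ²`, and it is consistent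
    (∀ (n : ℕ) (ω : Ω),
      WelfareGain.omegaHat ylo yhi δ δs (est n) (fun i : Fin n => w i ω) =
        WelfareGain.crossFit (est n) (fun i : Fin n => w i ω)
          (fun v γ => WelfareGain.psi ylo yhi δ δs v
            (WelfareGain.betaHat ylo yhi δ δs (est n) (fun i : Fin n => w i ω)) γ ^ 2)) ∧
    TendstoInMeasure P
      (fun (n : ℕ) (ω : Ω) =>
        WelfareGain.omegaHat ylo yhi δ δs (est n) (fun i : Fin n => w i ω))
      atTop (fun _ => WelfareGain.asymVar ylo yhi δ δs F₀ γ₀) := by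
  have hsc := measurable_score ylo yhi hδ hδs
  have hL2 := memLp_score hδ hδs hY 2
  have hint : Integrable (score ylo yhi δ δs) F₀ := (memLp_score hδ hδs hY 1).integrable le_rfl
  have hplug := integrable_plugIn_and_integral_eq hδ hδs hY hγ₀
  have hmean := integral_score_eq_betaLower hδ hδs hY hγ₀
  have hvar := asymVar_eq_variance_score hδ hδs hY hγ₀
  let S : ℕ → Ω → ℝ := fun i ω => score ylo yhi δ δs (w i ω)
  have hS : ∀ i, Measurable (S i) := fun i => hsc.comp (hw i)
  have hid : ∀ i, IdentDistrib (w i) (w 0) P P := fun i =>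
    ⟨(hw i).aemeasurable, (hw 0).aemeasurable, by rw [hlaw, hlaw]⟩
  have hSid : ∀ i, IdentDistrib (S i) (S 0) P P := fun i => (hid i).comp hsc
  have hSindep : iIndepFun S P := hindep.comp (fun _ => score ylo yhi δ δs) fun _ => hsc
  have hSL2 : MemLp (S 0) 2 P := by
    rw [← hlaw 0] at hL2
    exact hL2.comp_of_map (hw 0).aemeasurable
  have hSmean : P[S 0] = betaLower ylo yhi δ δs F₀ γ₀ := by
    rw [← hmean, ← hlaw 0, integral_map (hw 0).aemeasurable hsc.aestronglyMeasurable]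
  have hSvar : Var[S 0; P] = asymVar ylo yhi δ δs F₀ γ₀ := by
    rw [hvar, ← hlaw 0, variance_map hsc.aemeasurable (hw 0).aemeasurable]
    rfl
  have hsum : ∀ (f : ℝ → ℝ) (n : ℕ) (ω : Ω), ∑ i : Fin n, f (score ylo yhi δ δs (w i ω))
      = ∑ i ∈ Finset.range n, f (S i ω) := fun f n ω =>
    Fin.sum_univ_eq_sum_range (fun i => f (S i ω)) n
  have hsum' : ∀ (n : ℕ) (ω : Ω), ∑ i : Fin n, score ylo yhi δ δs (w i ω)
      = ∑ i ∈ Finset.range n, S i ω := hsum id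
  refine ⟨⟨hplug.1.sub (integrable_const _), ?_⟩, ⟨?_, ?_⟩, ?_, ?_, ?_, ?_, ?_⟩
  · unfold plugMoment
    rw [integral_sub hplug.1 (integrable_const _)]
    simp [betaLower]
  · simp only [psi_eq_score_sub]
    exact hL2.sub (memLp_const _)
  · simp only [psi_eq_score_sub]
    rw [integral_sub hint (integrable_const _), hmean]
    simp
  -- The integrand does not involve γ, so the map is constant in τ.
  · intro G _ _ γ _
    simp only [psi_eq_score_sub]
    exact ⟨fun _ _ => hint.sub (integrable_const _), hasDerivWithinAt_const _ _ _⟩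
  · intro n hn ω b
    have hn' : (n : ℝ) ≠ 0 := by positivity
    rw [crossFit_psi_eq, betaHat_eq_mean_score, Finset.sum_sub_distrib]
    simp only [Finset.sum_const, Finset.card_univ, Fintype.card_fin, nsmul_eq_mul]
    field_simp
    rw [mul_zero, sub_eq_zero, eq_comm]
  · have hZ : HasLaw (id : ℝ → ℝ) (gaussianReal 0 Var[S 0; P].toNNReal)
        (gaussianReal 0 (asymVar ylo yhi δ δs F₀ γ₀).toNNReal) := by
      rw [hSvar]
      exact HasLaw.id
    refine (tendstoInDistribution_inv_sqrt_mul_sum_sub hZ hSL2 hSindep hSid).congr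
      (fun n => ae_of_all _ fun ω => ?_) (ae_of_all _ fun _ => rfl)
    simp only
    rw [betaHat_eq_mean_score, hsum' n ω, hSmean]
    -- At n = 0 both sides vanish.
    rcases Nat.eq_zero_or_pos n with rfl | hn
    · simp
    have hn' : (0 : ℝ) < n := by positivity
    have h0 : √(n : ℝ) ≠ 0 := (Real.sqrt_pos.2 hn').ne'
    field_simp
    rw [Real.sq_sqrt hn'.le]
  · exact fun n ω => omegaHat_eq_crossFit_psi_sq ylo yhi δ δs (est n) _
  · have hSsq : ∀ i, IdentDistrib (fun ω => S i ω ^ 2) (fun ω => S 0 ω ^ 2) P P :=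
      fun i => (hSid i).comp (u := fun t => t ^ 2) (by fun_prop)
    have hpair : Pairwise (Function.onFun (fun f g => IndepFun f g P) S) :=
      fun i j hij => hSindep.indepFun hij
    have hpair2 : Pairwise (Function.onFun (fun f g => IndepFun f g P) fun i ω => S i ω ^ 2) :=
      fun i j hij => (hSindep.indepFun hij).comp (φ := fun t => t ^ 2) (ψ := fun t => t ^ 2)
        (by fun_prop) (by fun_prop)
    have h1 := strong_law_ae_real S (hSL2.integrable one_le_two) hpair hSid
    have h2 := strong_law_ae_real (fun i ω => S i ω ^ 2) hSL2.integrable_sq hpair2 hSsq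
    have heq : ∀ (n : ℕ) (ω : Ω), omegaHat ylo yhi δ δs (est n) (fun i : Fin n => w i ω)
        = (∑ i ∈ Finset.range n, S i ω ^ 2) / n - ((∑ i ∈ Finset.range n, S i ω) / n) ^ 2 := by
      intro n ω
      rw [omegaHat_eq_mean_sq_sub, hsum (fun t => t ^ 2) n ω, hsum' n ω]
      ring
    -- Measurability in ω is visible only in this form, since the first-step estimates are arbitrary
    -- functions of the sample.
    simp only [heq]
    refine tendstoInMeasure_of_tendsto_ae (fun n => ?_) ?_
    · exact Measurable.aestronglyMeasurable (by fun_prop)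
    · filter_upwards [h1, h2] with ω h1 h2
      rw [← hSvar, variance_eq_sub hSL2]
      exact h2.sub (h1.pow 2)
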